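/- Let $M$ be a complete non-compact smooth Riemannian manifold with metric $\langle\cdot,\cdot\rangle$ and Levi-Civita connection $D$. Let $V$ be a smooth vector field on $M$ that is closed conformal with smooth conformal factor $\phi:M\to\mathbb{R}$, i.e. $D_XV=\phi X$ for every vector field $X$, and suppose that $\langle\nabla\phi,V\rangle\ge 0$ on $M$. Put $f=\tfrac12\langle V,V\rangle$. Then: 1. $f$ is convex: for every geodesic $\gamma:[a,b]\to M$ and every $t\in[0,1]$, $f(\gamma((1-t)a+tb))\le(1-t)f(\gamma(a))+tf(\gamma(b))$. 2. $\mathrm{Hess}\,f(X,X)=\langle D_X\nabla f,X\rangle\ge\phi^2\langle X,X\rangle$ for every tangent vector $X$ of $M$. 3. If moreover neither $V$ nor $\phi$ vanishes at any point of $M$, then $f$ is strictly convex: the inequality in (1) is strict for every non-constant geodesic $\gamma:[a,b]\to M$ and every $t\in(0,1)$. -/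

import Mathlib

open Bundle Set
open scoped Manifold ContDiff

noncomputable section

namespace RiemGeom

section

variable {E : Type*} [NormedAddCommGroup E] [NormedSpace ℝ E] [FiniteDimensional ℝ E]
  {M : Type*} [TopologicalSpace M] [ChartedSpace E M]

theorem finiteDimensional_tangentSpace (x : M) : FiniteDimensional ℝ (TangentSpace 𝓘(ℝ, E) x) :=
  inferInstanceAs (FiniteDimensional ℝ E)

variable [RiemannianBundle (fun x : M ↦ TangentSpace 𝓘(ℝ, E) x)]

theorem completeSpace_tangentSpace (x : M) : CompleteSpace (TangentSpace 𝓘(ℝ, E) x) :=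
  haveI := finiteDimensional_tangentSpace (E := E) x
  FiniteDimensional.complete ℝ (TangentSpace 𝓘(ℝ, E) x)

/-- The Riesz isomorphism `T*ₓM → TₓM` ("sharp") of the metric: `⟨sharp x α, w⟩ = α w`. -/
def sharp (x : M) : (TangentSpace 𝓘(ℝ, E) x →L[ℝ] ℝ) →ₗ[ℝ] TangentSpace 𝓘(ℝ, E) x :=
  haveI := completeSpace_tangentSpace (E := E) x
  { toFun := fun α ↦ (InnerProductSpace.toDual ℝ (TangentSpace 𝓘(ℝ, E) x)).symm α
    map_add' := by simp
    map_smul' := by simp }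

theorem inner_sharp (x : M) (α : TangentSpace 𝓘(ℝ, E) x →L[ℝ] ℝ) (w : TangentSpace 𝓘(ℝ, E) x) :
    inner ℝ (sharp x α) w = α w := by
  have := completeSpace_tangentSpace (E := E) x
  simp [sharp]

/-- The gradient of `f`: the vector field with `⟨∇f, w⟩ = df(w)`. -/
def gradient (f : M → ℝ) (x : M) : TangentSpace 𝓘(ℝ, E) x :=
  sharp x (mvfderiv 𝓘(ℝ, E) f x)

/-- The right-hand side of the Koszul formula,
`X⟨Y,Z⟩ + Y⟨X,Z⟩ - Z⟨X,Y⟩ + ⟨[X,Y],Z⟩ - ⟨[X,Z],Y⟩ - ⟨[Y,Z],X⟩`, at the point `x`. -/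
def koszul (X Y Z : Π x : M, TangentSpace 𝓘(ℝ, E) x) (x : M) : ℝ :=
  mvfderiv 𝓘(ℝ, E) (fun y ↦ (inner ℝ (Y y) (Z y) : ℝ)) x (X x)
  + mvfderiv 𝓘(ℝ, E) (fun y ↦ (inner ℝ (X y) (Z y) : ℝ)) x (Y x)
  - mvfderiv 𝓘(ℝ, E) (fun y ↦ (inner ℝ (X y) (Y y) : ℝ)) x (Z x)
  + inner ℝ (VectorField.mlieBracket 𝓘(ℝ, E) X Y x) (Z x)
  - inner ℝ (VectorField.mlieBracket 𝓘(ℝ, E) X Z x) (Y x)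
  - inner ℝ (VectorField.mlieBracket 𝓘(ℝ, E) Y Z x) (X x)

variable [IsManifold 𝓘(ℝ, E) ∞ M]
  [IsContMDiffRiemannianBundle 𝓘(ℝ, E) ∞ E (fun x : M ↦ TangentSpace 𝓘(ℝ, E) x)]

theorem mdifferentiableAt_inner {X Y : Π x : M, TangentSpace 𝓘(ℝ, E) x} {x : M}
    (hX : MDiffAt (T% X) x) (hY : MDiffAt (T% Y) x) :
    MDiffAt (fun y ↦ (inner ℝ (X y) (Y y) : ℝ)) x :=
  MDifferentiableAt.inner_bundle (IB := 𝓘(ℝ, E)) (F := E)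
    (E := fun x : M ↦ TangentSpace 𝓘(ℝ, E) x) (b := id) hX hY

theorem mvfderiv_inner_smul_left {f : M → ℝ} {X Y : Π x : M, TangentSpace 𝓘(ℝ, E) x} {x : M}
    (hf : MDiffAt f x) (hX : MDiffAt (T% X) x) (hY : MDiffAt (T% Y) x) :
    mvfderiv 𝓘(ℝ, E) (fun y ↦ (inner ℝ ((f • X) y) (Y y) : ℝ)) x
      = f x • mvfderiv 𝓘(ℝ, E) (fun y ↦ (inner ℝ (X y) (Y y) : ℝ)) x
        + (inner ℝ (X x) (Y x) : ℝ) • mvfderiv 𝓘(ℝ, E) f x := by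
  simp [inner_smul_left, mvfderiv_fun_mul hf (mdifferentiableAt_inner hX hY)]

theorem mvfderiv_inner_smul_right {f : M → ℝ} {X Y : Π x : M, TangentSpace 𝓘(ℝ, E) x} {x : M}
    (hf : MDiffAt f x) (hX : MDiffAt (T% X) x) (hY : MDiffAt (T% Y) x) :
    mvfderiv 𝓘(ℝ, E) (fun y ↦ (inner ℝ (X y) ((f • Y) y) : ℝ)) x
      = f x • mvfderiv 𝓘(ℝ, E) (fun y ↦ (inner ℝ (X y) (Y y) : ℝ)) x
        + (inner ℝ (X x) (Y x) : ℝ) • mvfderiv 𝓘(ℝ, E) f x := by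
  simp [inner_smul_right, mvfderiv_fun_mul hf (mdifferentiableAt_inner hX hY)]

theorem mvfderiv_inner_add_left {X X' Y : Π x : M, TangentSpace 𝓘(ℝ, E) x} {x : M}
    (hX : MDiffAt (T% X) x) (hX' : MDiffAt (T% X') x) (hY : MDiffAt (T% Y) x) :
    mvfderiv 𝓘(ℝ, E) (fun y ↦ (inner ℝ ((X + X') y) (Y y) : ℝ)) x
      = mvfderiv 𝓘(ℝ, E) (fun y ↦ (inner ℝ (X y) (Y y) : ℝ)) x
        + mvfderiv 𝓘(ℝ, E) (fun y ↦ (inner ℝ (X' y) (Y y) : ℝ)) x := by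
  simp [inner_add_left, mvfderiv_fun_add (mdifferentiableAt_inner hX hY)
    (mdifferentiableAt_inner hX' hY)]

theorem mvfderiv_inner_add_right {X Y Y' : Π x : M, TangentSpace 𝓘(ℝ, E) x} {x : M}
    (hX : MDiffAt (T% X) x) (hY : MDiffAt (T% Y) x) (hY' : MDiffAt (T% Y') x) :
    mvfderiv 𝓘(ℝ, E) (fun y ↦ (inner ℝ (X y) ((Y + Y') y) : ℝ)) x
      = mvfderiv 𝓘(ℝ, E) (fun y ↦ (inner ℝ (X y) (Y y) : ℝ)) x
        + mvfderiv 𝓘(ℝ, E) (fun y ↦ (inner ℝ (X y) (Y' y) : ℝ)) x := by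
  simp [inner_add_right, mvfderiv_fun_add (mdifferentiableAt_inner hX hY)
    (mdifferentiableAt_inner hX hY')]

theorem koszul_tensorial_left {Y Z : Π x : M, TangentSpace 𝓘(ℝ, E) x} {x : M}
    (hY : MDiffAt (T% Y) x) (hZ : MDiffAt (T% Z) x) :
    TensorialAt 𝓘(ℝ, E) E (fun X ↦ koszul X Y Z x) x where
  smul {f X} hf hX := by
    simp only [koszul, mvfderiv_inner_smul_left hf hX hY, mvfderiv_inner_smul_left hf hX hZ,
      VectorField.mlieBracket_smul_left hf hX]
    simp [inner_add_left, inner_smul_left, inner_smul_right]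
    ring
  add {X X'} hX hX' := by
    simp only [koszul, mvfderiv_inner_add_left hX hX' hY, mvfderiv_inner_add_left hX hX' hZ,
      VectorField.mlieBracket_add_left hX hX']
    simp [inner_add_left, inner_add_right]
    ring

theorem koszul_tensorial_right {X Y : Π x : M, TangentSpace 𝓘(ℝ, E) x} {x : M}
    (hX : MDiffAt (T% X) x) (hY : MDiffAt (T% Y) x) :
    TensorialAt 𝓘(ℝ, E) E (fun Z ↦ koszul X Y Z x) x where
  smul {f Z} hf hZ := by
    simp only [koszul, mvfderiv_inner_smul_right hf hX hZ, mvfderiv_inner_smul_right hf hY hZ,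
      VectorField.mlieBracket_smul_right hf hZ]
    simp [inner_add_left, inner_smul_left, inner_smul_right, real_inner_comm]
    ring
  add {Z Z'} hZ hZ' := by
    simp only [koszul, mvfderiv_inner_add_right hX hZ hZ', mvfderiv_inner_add_right hY hZ hZ',
      VectorField.mlieBracket_add_right hZ hZ']
    simp [inner_add_left, inner_add_right]
    ring

theorem koszul_add_middle {X Y Y' Z : Π x : M, TangentSpace 𝓘(ℝ, E) x} {x : M}
    (hX : MDiffAt (T% X) x) (hY : MDiffAt (T% Y) x) (hY' : MDiffAt (T% Y') x)
    (hZ : MDiffAt (T% Z) x) :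
    koszul X (Y + Y') Z x = koszul X Y Z x + koszul X Y' Z x := by
  simp only [koszul, mvfderiv_inner_add_right hX hY hY', mvfderiv_inner_add_left hY hY' hZ,
    VectorField.mlieBracket_add_right hY hY', VectorField.mlieBracket_add_left hY hY']
  simp [inner_add_left, inner_add_right]
  ring

theorem koszul_smul_middle {f : M → ℝ} {X Y Z : Π x : M, TangentSpace 𝓘(ℝ, E) x} {x : M}
    (hf : MDiffAt f x) (hX : MDiffAt (T% X) x) (hY : MDiffAt (T% Y) x)
    (hZ : MDiffAt (T% Z) x) :
    koszul X (f • Y) Z x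
      = f x * koszul X Y Z x + 2 * mvfderiv 𝓘(ℝ, E) f x (X x) * inner ℝ (Y x) (Z x) := by
  simp only [koszul, mvfderiv_inner_smul_right hf hX hY, mvfderiv_inner_smul_left hf hY hZ,
    VectorField.mlieBracket_smul_right hf hY, VectorField.mlieBracket_smul_left hf hY]
  simp [inner_add_left, inner_smul_left, inner_smul_right, real_inner_comm]
  ring

/-- The Levi-Civita derivative `v ↦ D_v Y` at `x` of a vector field `Y` differentiable at `x`:
the vector `D_v Y` is determined by the Koszul formula `2⟨D_v Y, w⟩ = koszul X Y Z x`, where `X`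
and `Z` are any differentiable vector fields with `X x = v` and `Z x = w`. -/
def leviCivitaAt (Y : Π x : M, TangentSpace 𝓘(ℝ, E) x) (x : M) (hY : MDiffAt (T% Y) x) :
    TangentSpace 𝓘(ℝ, E) x →L[ℝ] TangentSpace 𝓘(ℝ, E) x :=
  haveI := finiteDimensional_tangentSpace (E := E) x
  LinearMap.toContinuousLinearMap
    ((1 / 2 : ℝ) • (sharp x ∘ₗ
      (TensorialAt.mkHom₂ (fun X Z ↦ koszul X Y Z x) x
        (fun _ hZ ↦ koszul_tensorial_left hY hZ)
        (fun _ hX ↦ koszul_tensorial_right hX hY)).toLinearMap))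

theorem inner_leviCivitaAt {X Y Z : Π x : M, TangentSpace 𝓘(ℝ, E) x} {x : M}
    (hX : MDiffAt (T% X) x) (hY : MDiffAt (T% Y) x) (hZ : MDiffAt (T% Z) x) :
    inner ℝ (leviCivitaAt Y x hY (X x)) (Z x) = koszul X Y Z x / 2 := by
  have h := TensorialAt.mkHom₂_apply (Φ := fun X Z ↦ koszul X Y Z x)
    (fun _ hZ ↦ koszul_tensorial_left hY hZ) (fun _ hX ↦ koszul_tensorial_right hX hY) hX hZ
  rw [← h]
  simp [leviCivitaAt, inner_smul_left, inner_sharp]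
  ring

open Classical in
/-- The Levi-Civita connection of the Riemannian manifold: `leviCivita Y x v` is `D_v Y` at `x`
(with value `0` if `Y` is not differentiable at `x`). -/
def leviCivita : CovariantDerivative 𝓘(ℝ, E) E (fun x : M ↦ TangentSpace 𝓘(ℝ, E) x) where
  toFun Y x := if hY : MDiffAt (T% Y) x then leviCivitaAt Y x hY else 0
  isCovariantDerivativeOnUniv :=
    { add := by
        intro Y Y' x hY hY' _
        have hs : MDiffAt (T% (Y + Y')) x := mdifferentiableAt_add_section hY hY'
        simp only [dif_pos hY, dif_pos hY', dif_pos hs]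
        ext v
        refine ext_inner_right ℝ fun w ↦ ?_
        have hv := FiberBundle.mdifferentiableAt_extend 𝓘(ℝ, E) E v
        have hw := FiberBundle.mdifferentiableAt_extend 𝓘(ℝ, E) E w
        have e1 := inner_leviCivitaAt hv hs hw
        have e2 := inner_leviCivitaAt hv hY hw
        have e3 := inner_leviCivitaAt hv hY' hw
        rw [koszul_add_middle hv hY hY' hw] at e1
        simp only [FiberBundle.extend_apply_self] at e1 e2 e3
        rw [add_apply, inner_add_left, e1, e2, e3]
        ring
      leibniz := by
        intro Y f x hY hf _
        have hs : MDiffAt (T% (f • Y)) x := hf.smul_section hY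
        simp only [dif_pos hY, dif_pos hs]
        ext v
        refine ext_inner_right ℝ fun w ↦ ?_
        have hv := FiberBundle.mdifferentiableAt_extend 𝓘(ℝ, E) E v
        have hw := FiberBundle.mdifferentiableAt_extend 𝓘(ℝ, E) E w
        have e1 := inner_leviCivitaAt hv hs hw
        have e2 := inner_leviCivitaAt hv hY hw
        rw [koszul_smul_middle hf hv hY hw] at e1
        simp only [FiberBundle.extend_apply_self] at e1 e2
        simp only [add_apply, smul_apply,
          ContinuousLinearMap.smulRight_apply, inner_add_left, inner_smul_left, e1, e2]
        simp
        ring }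

theorem inner_leviCivita {X Y Z : Π x : M, TangentSpace 𝓘(ℝ, E) x} {x : M}
    (hX : MDiffAt (T% X) x) (hY : MDiffAt (T% Y) x) (hZ : MDiffAt (T% Z) x) :
    inner ℝ (leviCivita Y x (X x)) (Z x) = koszul X Y Z x / 2 := by
  rw [← inner_leviCivitaAt hX hY hZ]
  exact congrArg (fun L : TangentSpace 𝓘(ℝ, E) x →L[ℝ] TangentSpace 𝓘(ℝ, E) x ↦
    inner ℝ (L (X x)) (Z x)) (dif_pos hY)

/-- The Levi-Civita connection has no torsion. -/
theorem torsion_leviCivita : (leviCivita (E := E) (M := M)).torsion = 0 := by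
  rw [CovariantDerivative.torsion_eq_zero_iff]
  intro X Y x hX hY
  refine ext_inner_right ℝ fun w ↦ ?_
  have hw := FiberBundle.mdifferentiableAt_extend 𝓘(ℝ, E) E w
  have e1 := inner_leviCivita hX hY hw
  have e2 := inner_leviCivita hY hX hw
  simp only [koszul, FiberBundle.extend_apply_self] at e1 e2
  rw [inner_sub_left, e1, e2, VectorField.mlieBracket_swap_apply (V := Y) (W := X)]
  simp [real_inner_comm]
  ring

/-- The Levi-Civita connection is compatible with the metric: `X⟨Y,Z⟩ = ⟨D_X Y, Z⟩ + ⟨Y, D_X Z⟩`. -/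
theorem mvfderiv_inner_eq_leviCivita {X Y Z : Π x : M, TangentSpace 𝓘(ℝ, E) x} {x : M}
    (hX : MDiffAt (T% X) x) (hY : MDiffAt (T% Y) x) (hZ : MDiffAt (T% Z) x) :
    mvfderiv 𝓘(ℝ, E) (fun y ↦ (inner ℝ (Y y) (Z y) : ℝ)) x (X x)
      = inner ℝ (leviCivita Y x (X x)) (Z x) + inner ℝ (Y x) (leviCivita Z x (X x)) := by
  have e1 := inner_leviCivita hX hY hZ
  have e2 := inner_leviCivita hX hZ hY
  rw [real_inner_comm] at e2
  rw [e1, e2]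
  simp only [koszul]
  rw [VectorField.mlieBracket_swap_apply (V := Z) (W := Y)]
  simp [real_inner_comm]
  ring

/-- The Hessian of `f` at `x`, as the operator `v ↦ D_v ∇f` of the tangent space. -/
def hessian (f : M → ℝ) (x : M) : TangentSpace 𝓘(ℝ, E) x →L[ℝ] TangentSpace 𝓘(ℝ, E) x :=
  leviCivita (gradient f) x

/-- A smooth vector field `V` is closed conformal with conformal factor `φ` if `φ` is smooth and
`D_X V = φ X` for all `X`. -/
structure IsClosedConformal (V : Π x : M, TangentSpace 𝓘(ℝ, E) x) (φ : M → ℝ) : Prop where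
  contMDiff_field : ContMDiff 𝓘(ℝ, E) 𝓘(ℝ, E).tangent ∞ (T% V)
  contMDiff_factor : ContMDiff 𝓘(ℝ, E) 𝓘(ℝ, ℝ) ∞ φ
  deriv_eq : ∀ (x : M) (v : TangentSpace 𝓘(ℝ, E) x), leviCivita V x v = φ x • v

/-- The velocity `γ'(t)` of a curve `γ` defined on `s ⊆ ℝ` (one-sided at endpoints of `s`). -/
def velocity (γ : ℝ → M) (s : Set ℝ) (t : ℝ) : TangentSpace 𝓘(ℝ, E) (γ t) :=
  mfderivWithin 𝓘(ℝ, ℝ) 𝓘(ℝ, E) γ s t (1 : ℝ)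

/-- The covariant derivative `DW/dt` at time `t` of a vector field `W` along the curve `γ : s → M`.
In the local frame `(eᵢ)` of `TM` given by the chart at `γ t`, write `W = ∑ Wⁱ eᵢ`; then
`DW/dt = ∑ (dWⁱ/dt) eᵢ + ∑ Wⁱ D_{γ'} eᵢ`. The first sum is the derivative of the coordinate
expression of `W`, read in `T_{γ t}M`; in the second, `∑ Wⁱ(t) eᵢ` is the local vector field with
constant coordinates which extends the vector `W t`. -/
def covDerivAlong (γ : ℝ → M) (s : Set ℝ) (W : Π t : ℝ, TangentSpace 𝓘(ℝ, E) (γ t)) (t : ℝ) :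
    TangentSpace 𝓘(ℝ, E) (γ t) :=
  (trivializationAt E (TangentSpace 𝓘(ℝ, E)) (γ t)).symmL ℝ (γ t)
    (derivWithin (fun τ ↦ (trivializationAt E (TangentSpace 𝓘(ℝ, E)) (γ t)
      (⟨γ τ, W τ⟩ : TangentBundle 𝓘(ℝ, E) M)).2) s t)
  + leviCivita (FiberBundle.extend E (W t)) (γ t) (velocity γ s t)

/-- `γ` restricted to `[a, b]` is a geodesic segment: it is smooth and `Dγ'/dt = 0`. -/
def IsGeodesicSegment (γ : ℝ → M) (a b : ℝ) : Prop :=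
  ContMDiffOn 𝓘(ℝ, ℝ) 𝓘(ℝ, E) ∞ γ (Icc a b) ∧
    ∀ t ∈ Icc a b, covDerivAlong (E := E) γ (Icc a b) (velocity γ (Icc a b)) t = 0

variable (E) in
/-- Geodesic convexity of a function. -/
def IsConvex (f : M → ℝ) : Prop :=
  ∀ (γ : ℝ → M) (a b : ℝ), a < b → IsGeodesicSegment (E := E) γ a b →
    ∀ t ∈ Icc (0 : ℝ) 1,
      f (γ ((1 - t) * a + t * b)) ≤ (1 - t) * f (γ a) + t * f (γ b)

variable (E) in
/-- Strict geodesic convexity of a function: the convexity inequality is strict in the interior of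
every geodesic segment which is not a single point. -/
def IsStrictConvex (f : M → ℝ) : Prop :=
  IsConvex E f ∧
  ∀ (γ : ℝ → M) (a b : ℝ), a < b → IsGeodesicSegment (E := E) γ a b →
    (∃ s ∈ Icc a b, γ s ≠ γ a) → ∀ t ∈ Ioo (0 : ℝ) 1,
      f (γ ((1 - t) * a + t * b)) < (1 - t) * f (γ a) + t * f (γ b)

end

end RiemGeom

end

/-!
Write `f = ½⟨V, V⟩`. Compatibility of the Levi-Civita connection with the metric gives
`df(X) = ⟨D_X V, V⟩ = φ⟨V, X⟩`, that is `∇f = φ V`, and the Leibniz rule then gives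
`Hess f(X, X) = φ²⟨X, X⟩ + dφ(X)⟨V, X⟩` (`hessian_half_inner`). Everything rests on the sign of the
last term. The Hessian is symmetric because `D` has no torsion and `df([X, Y])` is the commutator of
the derivatives along `X` and `Y` (`mvfderiv_mlieBracket`, `inner_hessian_comm`), and here symmetry
says `dφ(X)⟨V, Y⟩ = dφ(Y)⟨V, X⟩`. Taking `Y = V` and multiplying by `⟨V, X⟩` yields
`dφ(X)⟨V, X⟩ ⟨V, V⟩ = ⟨∇φ, V⟩ ⟨V, X⟩² ≥ 0`, so `dφ(X)⟨V, X⟩ ≥ 0`: trivially where `V = 0`, and by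
division elsewhere (`mvfderiv_factor_mul_inner_nonneg`). No curvature enters.

For convexity along a geodesic `γ`, the covariant derivative along a curve obeys the product rule
for the metric (`hasDerivWithinAt_inner_along`) and extends `D` (`covDerivAlong_comp`). Hence
`(f ∘ γ)' = φ⟨V, γ'⟩` and `(f ∘ γ)'' = dφ(γ')⟨V, γ'⟩ + φ²|γ'|² ≥ 0`, with one-sided derivatives at
the endpoints. The product rule also shows that `|γ'|` is constant. If it is zero, `γ` has length
zero, and it is constant because the distance of `M` is the Riemannian one. So a non-constant
geodesic has `γ' ≠ 0` everywhere, and if `φ` has no zeros then `(f ∘ γ)'' > 0`.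
-/

noncomputable section

namespace RiemGeom

/-! ### The Lie bracket as a commutator of derivations -/

section
open VectorField Filter
open scoped Topology
variable {E : Type*} [NormedAddCommGroup E] [NormedSpace ℝ E]
  {M : Type*} [TopologicalSpace M] [ChartedSpace E M] [IsManifold 𝓘(ℝ, E) ∞ M]

/-- The expression of a vector field in the chart at `x`, as a map of the model space. It is the
pullback used in the definition of `VectorField.mlieBracket`, with the tangent spaces of `E`
identified with `E`. -/
def chartField (x : M) (X : Π y : M, TangentSpace 𝓘(ℝ, E) y) : E → E :=
  mpullbackWithin 𝓘(ℝ, E) 𝓘(ℝ, E) (extChartAt 𝓘(ℝ, E) x).symm X (range 𝓘(ℝ, E))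

theorem mvfderiv_eq_fderiv_comp_symm {f : M → ℝ} {x : M}
    (hf : MDiffAt f x) (w : TangentSpace 𝓘(ℝ, E) x) :
    mvfderiv 𝓘(ℝ, E) f x w =
      fderiv ℝ (f ∘ (extChartAt 𝓘(ℝ, E) x).symm) (extChartAt 𝓘(ℝ, E) x x)
        (mfderiv 𝓘(ℝ, E) 𝓘(ℝ, E) (extChartAt 𝓘(ℝ, E) x) x w) := by
  set ψ := extChartAt 𝓘(ℝ, E) x with hψ
  have hx : ψ.symm (ψ x) = x := extChartAt_to_inv x
  have h1 : MDiffAt ψ.symm (ψ x) :=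
    (contMDiffOn_extChartAt_symm (I := 𝓘(ℝ, E)) (n := 1) x).contMDiffAt
      (extChartAt_target_mem_nhds x) |>.mdifferentiableAt one_ne_zero
  have h2 : MDiffAt (f ∘ ψ.symm) (ψ x) :=
    MDifferentiableAt.comp (ψ x) (by rw [hx]; exact hf) h1
  have h3 : MDiffAt ψ x := mdifferentiableAt_extChartAt (mem_chart_source E x)
  have h4 : f =ᶠ[𝓝 x] (f ∘ ψ.symm) ∘ ψ := by
    filter_upwards [extChartAt_source_mem_nhds (I := 𝓘(ℝ, E)) x] with y hy
    simp only [Function.comp_apply, hψ, (extChartAt 𝓘(ℝ, E) x).left_inv hy]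
  have h5 := mvfderiv_comp_apply x h2 h3 w
  rw [mvfderiv, h4.mfderiv_eq]
  refine h5.trans ?_
  rw [mvfderiv, mfderiv_eq_fderiv]
  rfl

theorem fderiv_comp_extChartAt_symm_chartField {f : M → ℝ} {x : M} {z : E}
    (hz : z ∈ (extChartAt 𝓘(ℝ, E) x).target)
    (hf : MDiffAt f ((extChartAt 𝓘(ℝ, E) x).symm z)) (X : Π x : M, TangentSpace 𝓘(ℝ, E) x) :
    fderiv ℝ (f ∘ (extChartAt 𝓘(ℝ, E) x).symm) z (chartField x X z) =
      mvfderiv 𝓘(ℝ, E) f ((extChartAt 𝓘(ℝ, E) x).symm z) (X ((extChartAt 𝓘(ℝ, E) x).symm z)) := by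
  have h := isInvertible_mfderivWithin_extChartAt_symm (I := 𝓘(ℝ, E)) hz
  have h1 : MDifferentiableWithinAt 𝓘(ℝ, E) 𝓘(ℝ, E) (extChartAt 𝓘(ℝ, E) x).symm
      (range 𝓘(ℝ, E)) z :=
    mdifferentiableWithinAt_extChartAt_symm (I := 𝓘(ℝ, E)) (x := x) hz
  have h2 := congrArg (fun L : E →L[ℝ] ℝ ↦ L (chartField x X z))
    (mvfderiv_comp_mfderivWithin z hf h1 (𝓘(ℝ, E).uniqueMDiffOn _ (by simp)))
  have h3 : mvfderivWithin 𝓘(ℝ, E) (f ∘ (extChartAt 𝓘(ℝ, E) x).symm) (range 𝓘(ℝ, E)) z =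
      fderiv ℝ (f ∘ (extChartAt 𝓘(ℝ, E) x).symm) z := by
    rw [ModelWithCorners.range_eq_univ, mvfderivWithin_univ, mvfderiv, mfderiv_eq_fderiv]
    rfl
  refine ((congrArg (fun L : E →L[ℝ] ℝ ↦ L (chartField x X z)) h3).symm.trans h2).trans ?_
  exact congrArg (mvfderiv 𝓘(ℝ, E) f ((extChartAt 𝓘(ℝ, E) x).symm z))
    (h.self_apply_inverse (X ((extChartAt 𝓘(ℝ, E) x).symm z)))

/-- Read in the chart at `x`, this is the commutator formula in the model space. -/
theorem mvfderiv_mlieBracket [CompleteSpace E] {f : M → ℝ}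
    {X Y : Π x : M, TangentSpace 𝓘(ℝ, E) x} {x : M}
    (hf : ContMDiff 𝓘(ℝ, E) 𝓘(ℝ, ℝ) ∞ f) (hX : MDiffAt (T% X) x) (hY : MDiffAt (T% Y) x) :
    mvfderiv 𝓘(ℝ, E) f x (mlieBracket 𝓘(ℝ, E) X Y x) =
      mvfderiv 𝓘(ℝ, E) (fun y ↦ mvfderiv 𝓘(ℝ, E) f y (Y y)) x (X x)
        - mvfderiv 𝓘(ℝ, E) (fun y ↦ mvfderiv 𝓘(ℝ, E) f y (X y)) x (Y x) := by
  set ψ := extChartAt 𝓘(ℝ, E) x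
  have hzx : ψ x ∈ ψ.target := mem_extChartAt_target x
  have hx : ψ.symm (ψ x) = x := extChartAt_to_inv x
  have hfd : ∀ y, MDiffAt f y := fun y ↦ (hf y).mdifferentiableAt (by simp)
  have hF : ContDiffAt ℝ ∞ (f ∘ ψ.symm) (ψ x) := by
    rw [← contMDiffAt_iff_contDiffAt]
    have h1 := contMDiffOn_extChartAt_symm (I := 𝓘(ℝ, E)) (n := ∞) x
    exact (hf.contMDiffAt).comp _ (h1.contMDiffAt (extChartAt_target_mem_nhds x))
  have hdiff : ∀ Z : Π x : M, TangentSpace 𝓘(ℝ, E) x, MDiffAt (T% Z) x →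
      DifferentiableAt ℝ (chartField x Z) (ψ x) := by
    intro Z hZ
    rw [← mdifferentiableWithinAt_univ] at hZ
    have h : DifferentiableWithinAt ℝ (chartField x Z) (ψ.symm ⁻¹' univ ∩ range 𝓘(ℝ, E)) (ψ x) :=
      hZ.differentiableWithinAt_mpullbackWithin_vectorField
    rwa [ModelWithCorners.range_eq_univ, preimage_univ, inter_self,
      differentiableWithinAt_univ] at h
  have htar : ∀ᶠ z in 𝓝 (ψ x), z ∈ ψ.target := extChartAt_target_mem_nhds x
  have hev : ∀ Z : Π x : M, TangentSpace 𝓘(ℝ, E) x,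
      (fun z ↦ fderiv ℝ (f ∘ ψ.symm) z (chartField x Z z)) =ᶠ[𝓝 (ψ x)]
      (fun y ↦ mvfderiv 𝓘(ℝ, E) f y (Z y)) ∘ ψ.symm := by
    intro Z
    filter_upwards [htar] with z hz
    exact fderiv_comp_extChartAt_symm_chartField hz (hfd _) Z
  have hg : ∀ Z : Π x : M, TangentSpace 𝓘(ℝ, E) x, MDiffAt (T% Z) x →
      MDiffAt (fun y ↦ mvfderiv 𝓘(ℝ, E) f y (Z y)) x := by
    intro Z hZ
    have h1 : DifferentiableAt ℝ (fun z ↦ fderiv ℝ (f ∘ ψ.symm) z (chartField x Z z)) (ψ x) :=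
      ((hF.fderiv_right (m := 1) (by norm_cast)).differentiableAt one_ne_zero).clm_apply
        (hdiff Z hZ)
    have h2 := ((hev Z).differentiableAt_iff.1 h1).mdifferentiableAt
    have h3 := h2.comp x (mdifferentiableAt_extChartAt (I := 𝓘(ℝ, E)) (mem_chart_source E x))
    refine h3.congr_of_eventuallyEq ?_
    filter_upwards [extChartAt_source_mem_nhds (I := 𝓘(ℝ, E)) x] with y hy
    exact congrArg (fun y ↦ mvfderiv 𝓘(ℝ, E) f y (Z y)) (ψ.left_inv hy).symm
  have hder : ∀ (Z W : Π x : M, TangentSpace 𝓘(ℝ, E) x), MDiffAt (T% Z) x →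
      fderiv ℝ (fun z ↦ fderiv ℝ (f ∘ ψ.symm) z (chartField x Z z)) (ψ x)
        (chartField x W (ψ x)) =
      mvfderiv 𝓘(ℝ, E) (fun y ↦ mvfderiv 𝓘(ℝ, E) f y (Z y)) x (W x) := by
    intro Z W hZ
    rw [(hev Z).fderiv_eq]
    have := fderiv_comp_extChartAt_symm_chartField hzx
      (f := fun y ↦ mvfderiv 𝓘(ℝ, E) f y (Z y)) (by rw [hx]; exact hg Z hZ) W
    rw [hx] at this
    exact this
  rw [← hder Y X hY, ← hder X Y hX]
  rw [← fderiv_apply_lieBracket hF (by simpa using (by norm_cast)) (hdiff Y hY) (hdiff X hX)]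
  rw [mvfderiv_eq_fderiv_comp_symm (hfd x)]
  congr 1
  have h : lieBracketWithin ℝ (chartField x X) (chartField x Y)
      (ψ.symm ⁻¹' univ ∩ range 𝓘(ℝ, E)) (ψ x) =
      lieBracket ℝ (chartField x X) (chartField x Y) (ψ x) := by
    rw [ModelWithCorners.range_eq_univ, preimage_univ, inter_self, lieBracketWithin_univ]
  rw [← h]
  exact (isInvertible_mfderiv_extChartAt (mem_extChartAt_source x)).self_apply_inverse _
end

/-! ### The Hessian, and closed conformal vector fields -/

section
open VectorField
variable {E : Type*} [NormedAddCommGroup E] [NormedSpace ℝ E] [FiniteDimensional ℝ E]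
  {M : Type*} [TopologicalSpace M] [ChartedSpace E M] [IsManifold 𝓘(ℝ, E) ∞ M]
  [RiemannianBundle (fun x : M ↦ TangentSpace 𝓘(ℝ, E) x)]

omit [IsManifold 𝓘(ℝ, E) ∞ M] in
theorem inner_gradient (f : M → ℝ) (x : M) (w : TangentSpace 𝓘(ℝ, E) x) :
    inner ℝ (gradient f x) w = mvfderiv 𝓘(ℝ, E) f x w :=
  inner_sharp x _ w

variable [IsContMDiffRiemannianBundle 𝓘(ℝ, E) ∞ E (fun x : M ↦ TangentSpace 𝓘(ℝ, E) x)]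

theorem leviCivita_smul {f : M → ℝ} {Y : Π x : M, TangentSpace 𝓘(ℝ, E) x} {x : M}
    (hf : MDiffAt f x) (hY : MDiffAt (T% Y) x) (v : TangentSpace 𝓘(ℝ, E) x) :
    leviCivita (f • Y) x v = f x • leviCivita Y x v + mvfderiv 𝓘(ℝ, E) f x v • Y x :=
  congrArg (fun L : TangentSpace 𝓘(ℝ, E) x →L[ℝ] TangentSpace 𝓘(ℝ, E) x ↦ L v)
    (leviCivita.isCovariantDerivativeOnUniv.leibniz hY hf)

/-- The Hessian is symmetric: by compatibility with the metric, `⟨D_X ∇f, Y⟩ - ⟨D_Y ∇f, X⟩` equals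
`X(Yf) - Y(Xf) - (D_X Y - D_Y X)f`, which vanishes since `D` has no torsion. -/
theorem inner_hessian_comm {f : M → ℝ} (hf : ContMDiff 𝓘(ℝ, E) 𝓘(ℝ, ℝ) ∞ f) {x : M}
    (hG : MDiffAt (T% (gradient (E := E) f)) x) (v w : TangentSpace 𝓘(ℝ, E) x) :
    inner ℝ (hessian f x v) w = inner ℝ (hessian f x w) v := by
  have := FiniteDimensional.complete ℝ E
  have hX := FiberBundle.mdifferentiableAt_extend 𝓘(ℝ, E) E v
  have hY := FiberBundle.mdifferentiableAt_extend 𝓘(ℝ, E) E w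
  have e1 := mvfderiv_inner_eq_leviCivita hX hG hY
  have e2 := mvfderiv_inner_eq_leviCivita hY hG hX
  have e3 := mvfderiv_mlieBracket hf hX hY
  have e4 := (CovariantDerivative.torsion_eq_zero_iff _).1
    (torsion_leviCivita (E := E) (M := M)) hX hY
  rw [← e4, map_sub] at e3
  simp only [inner_gradient] at e1 e2
  rw [e1, e2] at e3
  simp only [FiberBundle.extend_apply_self] at e3
  simp only [hessian]
  linarith

namespace IsClosedConformal

variable {V : Π x : M, TangentSpace 𝓘(ℝ, E) x} {φ : M → ℝ}

theorem mdifferentiableAt_field (hV : IsClosedConformal V φ) (x : M) : MDiffAt (T% V) x :=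
  (hV.contMDiff_field x).mdifferentiableAt (by simp)

theorem mdifferentiableAt_factor (hV : IsClosedConformal V φ) (x : M) : MDiffAt φ x :=
  (hV.contMDiff_factor x).mdifferentiableAt (by simp)

theorem contMDiff_half_inner (hV : IsClosedConformal V φ) :
    ContMDiff 𝓘(ℝ, E) 𝓘(ℝ, ℝ) ∞ (fun y ↦ 1 / 2 * (inner ℝ (V y) (V y) : ℝ)) :=
  contMDiff_const.mul (ContMDiff.inner_bundle (IB := 𝓘(ℝ, E)) (F := E)
    (E := fun x : M ↦ TangentSpace 𝓘(ℝ, E) x) (b := id) hV.contMDiff_field hV.contMDiff_field)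

theorem mvfderiv_half_inner (hV : IsClosedConformal V φ) (x : M) (w : TangentSpace 𝓘(ℝ, E) x) :
    mvfderiv 𝓘(ℝ, E) (fun y ↦ 1 / 2 * (inner ℝ (V y) (V y) : ℝ)) x w
      = φ x * inner ℝ (V x) w := by
  have hx := hV.mdifferentiableAt_field x
  have e := mvfderiv_inner_eq_leviCivita (FiberBundle.mdifferentiableAt_extend 𝓘(ℝ, E) E w) hx hx
  simp only [FiberBundle.extend_apply_self, hV.deriv_eq] at e
  rw [mvfderiv_fun_mul mdifferentiableAt_const (mdifferentiableAt_inner hx hx)]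
  simp only [mvfderiv_const, smul_zero, add_zero, smul_apply, e, inner_smul_left, inner_smul_right,
    RCLike.conj_to_real, real_inner_comm w, smul_eq_mul]
  ring

theorem gradient_half_inner (hV : IsClosedConformal V φ) :
    gradient (E := E) (fun y ↦ 1 / 2 * (inner ℝ (V y) (V y) : ℝ)) = φ • V := by
  funext x
  refine ext_inner_right ℝ fun w ↦ ?_
  rw [inner_gradient, hV.mvfderiv_half_inner]
  simp [inner_smul_left]

theorem hessian_half_inner (hV : IsClosedConformal V φ) (x : M) (v : TangentSpace 𝓘(ℝ, E) x) :
    hessian (fun y ↦ 1 / 2 * (inner ℝ (V y) (V y) : ℝ)) x v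
      = φ x ^ 2 • v + mvfderiv 𝓘(ℝ, E) φ x v • V x := by
  rw [hessian, hV.gradient_half_inner,
    leviCivita_smul (hV.mdifferentiableAt_factor x) (hV.mdifferentiableAt_field x), hV.deriv_eq,
    smul_smul, sq]

/-- `dφ ∧ V♭ = 0`: the symmetry of the Hessian of `½⟨V, V⟩`. -/
theorem mvfderiv_factor_mul_inner_comm (hV : IsClosedConformal V φ) (x : M)
    (v w : TangentSpace 𝓘(ℝ, E) x) :
    mvfderiv 𝓘(ℝ, E) φ x v * inner ℝ (V x) w = mvfderiv 𝓘(ℝ, E) φ x w * inner ℝ (V x) v := by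
  have hG : MDiffAt (T% (gradient (E := E) (fun y ↦ 1 / 2 * (inner ℝ (V y) (V y) : ℝ)))) x := by
    rw [hV.gradient_half_inner]
    exact (hV.mdifferentiableAt_factor x).smul_section (hV.mdifferentiableAt_field x)
  have h := inner_hessian_comm hV.contMDiff_half_inner hG v w
  simp only [hV.hessian_half_inner, inner_add_left, inner_smul_left, RCLike.conj_to_real,
    real_inner_comm v w] at h
  linarith

theorem mvfderiv_factor_mul_inner_nonneg (hV : IsClosedConformal V φ)
    (hφV : ∀ x : M, 0 ≤ inner ℝ (gradient (E := E) φ x) (V x)) (x : M)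
    (v : TangentSpace 𝓘(ℝ, E) x) :
    0 ≤ mvfderiv 𝓘(ℝ, E) φ x v * inner ℝ (V x) v := by
  rcases eq_or_ne (V x) 0 with h0 | h0
  · simp [h0]
  have hpos : 0 < (inner ℝ (V x) (V x) : ℝ) := real_inner_self_pos.2 h0
  have hd : 0 ≤ mvfderiv 𝓘(ℝ, E) φ x (V x) := by
    rw [← inner_gradient]; exact hφV x
  have h := hV.mvfderiv_factor_mul_inner_comm x v (V x)
  -- Multiply by `⟨V, V⟩ > 0` and use the symmetry with `w = V`.
  refine nonneg_of_mul_nonneg_left (b := inner ℝ (V x) (V x)) ?_ hpos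
  calc (0 : ℝ) ≤ mvfderiv 𝓘(ℝ, E) φ x (V x) * (inner ℝ (V x) v) ^ 2 := by positivity
    _ = _ := by linear_combination (-(inner ℝ (V x) v : ℝ)) * h

theorem sq_factor_mul_inner_le_inner_hessian (hV : IsClosedConformal V φ)
    (hφV : ∀ x : M, 0 ≤ inner ℝ (gradient (E := E) φ x) (V x)) (x : M)
    (v : TangentSpace 𝓘(ℝ, E) x) :
    φ x ^ 2 * inner ℝ v v ≤
      inner ℝ (hessian (fun y ↦ 1 / 2 * (inner ℝ (V y) (V y) : ℝ)) x v) v := by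
  rw [hV.hessian_half_inner, inner_add_left, inner_smul_left, inner_smul_left]
  simpa using hV.mvfderiv_factor_mul_inner_nonneg hφV x v

end IsClosedConformal
end

/-! ### Vector fields along curves -/

section
open Filter
open scoped Topology
variable {E : Type*} [NormedAddCommGroup E] [NormedSpace ℝ E]

/-- The product rule for a curve of bilinear forms. The derivative `H'` of the curve is only
recorded through its values, which `hasDerivWithinAt_inner_along` identifies. -/
theorem exists_hasDerivWithinAt_bilin_apply {H : ℝ → E →L[ℝ] E →L[ℝ] ℝ}
    {s : Set ℝ} {t : ℝ} (hH : DifferentiableWithinAt ℝ H s t) :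
    ∃ H' : E → E → ℝ,
      (∀ u v, HasDerivWithinAt (fun τ ↦ H τ u v) (H' u v) s t) ∧
      ∀ w w' : ℝ → E, DifferentiableWithinAt ℝ w s t → DifferentiableWithinAt ℝ w' s t →
        HasDerivWithinAt (fun τ ↦ H τ (w τ) (w' τ))
          (H' (w t) (w' t) + H t (derivWithin w s t) (w' t) + H t (w t) (derivWithin w' s t))
          s t := by
  -- Unification does not find the norm on `E →L[ℝ] E →L[ℝ] ℝ` by itself.
  have hH' : HasDerivWithinAt H (derivWithin H s t) s t :=
    DifferentiableWithinAt.hasDerivWithinAt (𝕜 := ℝ) (F := E →L[ℝ] E →L[ℝ] ℝ) (f := H) hH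
  refine ⟨fun u v ↦ derivWithin H s t u v, fun u v ↦ ?_, fun w w' hw hw' ↦ ?_⟩
  · simpa using (hH'.clm_apply (hasDerivWithinAt_const t s u)).clm_apply
      (hasDerivWithinAt_const t s v)
  · simpa using (hH'.clm_apply hw.hasDerivWithinAt).clm_apply hw'.hasDerivWithinAt

variable {M : Type*} [TopologicalSpace M] [ChartedSpace E M]

theorem hasDerivWithinAt_comp_curve {f : M → ℝ} {γ : ℝ → M} {s : Set ℝ} {t : ℝ}
    (hs : UniqueDiffWithinAt ℝ s t) (hf : MDiffAt f (γ t))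
    (hγ : MDifferentiableWithinAt 𝓘(ℝ, ℝ) 𝓘(ℝ, E) γ s t) :
    HasDerivWithinAt (fun τ ↦ f (γ τ)) (mvfderiv 𝓘(ℝ, E) f (γ t) (velocity γ s t)) s t := by
  have h1 : DifferentiableWithinAt ℝ (f ∘ γ) s t :=
    (hf.comp_mdifferentiableWithinAt t hγ).differentiableWithinAt
  have h2 := mfderiv_comp_mfderivWithin t hf hγ hs.uniqueMDiffWithinAt
  have h3 : derivWithin (f ∘ γ) s t = mvfderiv 𝓘(ℝ, E) f (γ t) (velocity γ s t) := by
    rw [← fderivWithin_derivWithin, ← mfderivWithin_eq_fderivWithin, h2]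
    rfl
  rw [← h3]
  exact h1.hasDerivWithinAt

variable [IsManifold 𝓘(ℝ, E) ∞ M]

theorem contMDiffOn_trivializationAt_symm (x : M) (u : E) :
    ContMDiffOn 𝓘(ℝ, E) 𝓘(ℝ, E).tangent ∞
      (T% (fun y ↦ (trivializationAt E (TangentSpace 𝓘(ℝ, E)) x).symm y u))
      (trivializationAt E (TangentSpace 𝓘(ℝ, E)) x).baseSet := by
  set e := trivializationAt E (TangentSpace 𝓘(ℝ, E) : M → Type _) x
  intro y hy
  rw [e.contMDiffWithinAt_section _ hy]
  have : ContMDiffOn 𝓘(ℝ, E) 𝓘(ℝ, E) ∞ (fun _ : M ↦ u) e.baseSet := contMDiffOn_const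
  refine this.congr (fun z hz ↦ ?_) y hy
  simp [hz]

/-- The coordinate expression, as a function of `τ`, of the vector field `W` along `γ` in the
trivialization of the tangent bundle at `γ t`. -/
def coordAlong (γ : ℝ → M) (W : Π t : ℝ, TangentSpace 𝓘(ℝ, E) (γ t)) (t τ : ℝ) : E :=
  (trivializationAt E (TangentSpace 𝓘(ℝ, E)) (γ t) (⟨γ τ, W τ⟩ : TangentBundle 𝓘(ℝ, E) M)).2

theorem differentiableWithinAt_coordAlong_comp {γ : ℝ → M} {s : Set ℝ} {t : ℝ}
    {Y : Π x : M, TangentSpace 𝓘(ℝ, E) x}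
    (hγ : MDifferentiableWithinAt 𝓘(ℝ, ℝ) 𝓘(ℝ, E) γ s t) (hY : MDiffAt (T% Y) (γ t)) :
    DifferentiableWithinAt ℝ (coordAlong γ (fun τ ↦ Y (γ τ)) t) s t := by
  have h := (mdifferentiableWithinAt_totalSpace 𝓘(ℝ, E)
    (f := fun τ ↦ (⟨γ τ, Y (γ τ)⟩ : TangentBundle 𝓘(ℝ, E) M))).1
    (hY.comp_mdifferentiableWithinAt t hγ)
  exact h.2.differentiableWithinAt

theorem differentiableWithinAt_coordAlong_velocity {γ : ℝ → M} {s : Set ℝ} {t : ℝ}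
    (hs : UniqueDiffOn ℝ s) (ht : t ∈ s) (hγ : ContMDiffOn 𝓘(ℝ, ℝ) 𝓘(ℝ, E) ∞ γ s) :
    DifferentiableWithinAt ℝ (coordAlong γ (velocity (E := E) γ s) t) s t := by
  have h1 : ContMDiffOn 𝓘(ℝ, ℝ).tangent 𝓘(ℝ, E).tangent 1
      (tangentMapWithin 𝓘(ℝ, ℝ) 𝓘(ℝ, E) γ s)
      ((TotalSpace.proj : TangentBundle 𝓘(ℝ, ℝ) ℝ → ℝ) ⁻¹' s) :=
    hγ.contMDiffOn_tangentMapWithin (by norm_cast) hs.uniqueMDiffOn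
  -- The velocity is the tangent map of `γ` along the unit vector field of `ℝ`.
  have h2 : ContMDiff 𝓘(ℝ, ℝ) 𝓘(ℝ, ℝ).tangent 1
      (fun τ : ℝ ↦ (⟨τ, (1 : ℝ)⟩ : TangentBundle 𝓘(ℝ, ℝ) ℝ)) := by
    intro τ
    rw [contMDiffAt_totalSpace]
    refine ⟨contMDiffAt_id, ?_⟩
    simpa using contMDiffAt_const
  have h3 : ContMDiffOn 𝓘(ℝ, ℝ) 𝓘(ℝ, E).tangent 1
      (fun τ ↦ (⟨γ τ, velocity γ s τ⟩ : TangentBundle 𝓘(ℝ, E) M)) s :=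
    h1.comp h2.contMDiffOn (fun τ hτ ↦ hτ)
  have h4 := (mdifferentiableWithinAt_totalSpace 𝓘(ℝ, E)
    (f := fun τ ↦ (⟨γ τ, velocity γ s τ⟩ : TangentBundle 𝓘(ℝ, E) M))).1
    ((h3 t ht).mdifferentiableWithinAt one_ne_zero)
  exact h4.2.differentiableWithinAt

variable [FiniteDimensional ℝ E] [RiemannianBundle (fun x : M ↦ TangentSpace 𝓘(ℝ, E) x)]

/-- The metric at `y`, read in the trivialization of the tangent bundle at `x`. It is meaningful for
`y` in the base set of the trivialization, and zero elsewhere. -/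
def metricInTrivialization (x y : M) : E →L[ℝ] E →L[ℝ] ℝ :=
  (innerSL ℝ (E := TangentSpace 𝓘(ℝ, E) y)).bilinearComp
    ((trivializationAt E (TangentSpace 𝓘(ℝ, E)) x).symmL ℝ y)
    ((trivializationAt E (TangentSpace 𝓘(ℝ, E)) x).symmL ℝ y)

omit [FiniteDimensional ℝ E] in
theorem metricInTrivialization_apply {x y : M}
    (hy : y ∈ (trivializationAt E (TangentSpace 𝓘(ℝ, E)) x).baseSet) (u v : E) :
    metricInTrivialization x y u v =
      inner ℝ ((trivializationAt E (TangentSpace 𝓘(ℝ, E)) x).symm y u)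
        ((trivializationAt E (TangentSpace 𝓘(ℝ, E)) x).symm y v) := by
  simp only [metricInTrivialization, ContinuousLinearMap.bilinearComp_apply, innerSL_apply_apply]
  rw [Trivialization.symmL_apply _ hy, Trivialization.symmL_apply _ hy]

variable [IsContMDiffRiemannianBundle 𝓘(ℝ, E) ∞ E (fun x : M ↦ TangentSpace 𝓘(ℝ, E) x)]

theorem differentiableWithinAt_metricInTrivialization {γ : ℝ → M} {s : Set ℝ} {t : ℝ} (ht : t ∈ s)
    (hγ : ContMDiffOn 𝓘(ℝ, ℝ) 𝓘(ℝ, E) ∞ γ s) :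
    DifferentiableWithinAt ℝ (fun τ ↦ metricInTrivialization (E := E) (γ t) (γ τ)) s t := by
  set e := trivializationAt E (TangentSpace 𝓘(ℝ, E) : M → Type _) (γ t)
  have hmem : γ t ∈ e.baseSet := FiberBundle.mem_baseSet_trivializationAt' (γ t)
  have hnhds : γ ⁻¹' e.baseSet ∈ 𝓝[s] t :=
    (hγ t ht).continuousWithinAt (e.open_baseSet.mem_nhds hmem)
  have hS : ContDiffOn ℝ ∞ (fun τ ↦ metricInTrivialization (E := E) (γ t) (γ τ))
      (s ∩ γ ⁻¹' e.baseSet) := by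
    rw [contDiffOn_clm_apply]
    intro u
    rw [contDiffOn_clm_apply]
    intro v
    rw [← contMDiffOn_iff_contDiffOn]
    have h := ContMDiffOn.inner_bundle (IB := 𝓘(ℝ, E)) (F := E)
      (E := fun x : M ↦ TangentSpace 𝓘(ℝ, E) x) (b := id)
      (contMDiffOn_trivializationAt_symm (γ t) u) (contMDiffOn_trivializationAt_symm (γ t) v)
    exact (h.comp (hγ.mono inter_subset_left) inter_subset_right).congr
      fun τ hτ ↦ metricInTrivialization_apply hτ.2 u v
  refine ((hS.differentiableOn (by simp)) t ⟨ht, hmem⟩).mono_of_mem_nhdsWithin ?_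
  exact inter_mem self_mem_nhdsWithin hnhds

theorem covDerivAlong_eq (γ : ℝ → M) (s : Set ℝ) (W : Π t : ℝ, TangentSpace 𝓘(ℝ, E) (γ t)) (t : ℝ) :
    covDerivAlong γ s W t =
      (trivializationAt E (TangentSpace 𝓘(ℝ, E)) (γ t)).symmL ℝ (γ t)
        (derivWithin (coordAlong γ W t) s t)
      + leviCivita (FiberBundle.extend E (W t)) (γ t) (velocity γ s t) := rfl

/-- The product rule for the metric along a curve. In the trivialization at `γ t`, the derivatives
of the coordinates of `W` and `W'` account for the first summands of `covDerivAlong`, and the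
derivative of the metric for the second ones. -/
theorem hasDerivWithinAt_inner_along {γ : ℝ → M} {s : Set ℝ} {t : ℝ}
    {W W' : Π t : ℝ, TangentSpace 𝓘(ℝ, E) (γ t)} (hs : UniqueDiffWithinAt ℝ s t) (ht : t ∈ s)
    (hγ : ContMDiffOn 𝓘(ℝ, ℝ) 𝓘(ℝ, E) ∞ γ s)
    (hW : DifferentiableWithinAt ℝ (coordAlong γ W t) s t)
    (hW' : DifferentiableWithinAt ℝ (coordAlong γ W' t) s t) :
    HasDerivWithinAt (fun τ ↦ (inner ℝ (W τ) (W' τ) : ℝ))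
      (inner ℝ (covDerivAlong γ s W t) (W' t) + inner ℝ (W t) (covDerivAlong γ s W' t)) s t := by
  set e := trivializationAt E (TangentSpace 𝓘(ℝ, E) : M → Type _) (γ t) with he
  have hmem : γ t ∈ e.baseSet := FiberBundle.mem_baseSet_trivializationAt' (γ t)
  have hnhds : ∀ᶠ τ in 𝓝[s] t, γ τ ∈ e.baseSet :=
    (hγ t ht).continuousWithinAt (e.open_baseSet.mem_nhds hmem)
  have hγt := (hγ t ht).mdifferentiableWithinAt (by simp)
  obtain ⟨H', hH', hH⟩ :=
    exists_hasDerivWithinAt_bilin_apply (differentiableWithinAt_metricInTrivialization ht hγ)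
  have hsymm : ∀ (Z : Π t : ℝ, TangentSpace 𝓘(ℝ, E) (γ t)) {τ}, γ τ ∈ e.baseSet →
      e.symm (γ τ) (coordAlong γ Z t τ) = Z τ := by
    intro Z τ hτ
    exact e.symm_apply_apply_mk hτ (Z τ)
  -- Along fields with constant coordinates only the metric varies, and `D` is compatible with it.
  have hconst : H' (coordAlong γ W t t) (coordAlong γ W' t t) =
      inner ℝ (leviCivita (FiberBundle.extend E (W t)) (γ t) (velocity γ s t)) (W' t)
      + inner ℝ (W t) (leviCivita (FiberBundle.extend E (W' t)) (γ t) (velocity γ s t)) := by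
    have hY := FiberBundle.mdifferentiableAt_extend 𝓘(ℝ, E) E (W t)
    have hY' := FiberBundle.mdifferentiableAt_extend 𝓘(ℝ, E) E (W' t)
    have h1 := hH' (coordAlong γ W t t) (coordAlong γ W' t t)
    have h2 := hasDerivWithinAt_comp_curve hs (mdifferentiableAt_inner hY hY') hγt
    have h3 := mvfderiv_inner_eq_leviCivita
      (FiberBundle.mdifferentiableAt_extend 𝓘(ℝ, E) E (velocity γ s t)) hY hY'
    simp only [FiberBundle.extend_apply_self] at h3
    rw [h3] at h2
    refine hs.eq_deriv s h1 (h2.congr_of_eventuallyEq (hnhds.mono fun τ hτ ↦ ?_) ?_)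
    · exact metricInTrivialization_apply hτ _ _
    · exact metricInTrivialization_apply hmem _ _
  have hD := hH _ _ hW hW'
  have hval : ∀ τ, γ τ ∈ e.baseSet → (inner ℝ (W τ) (W' τ) : ℝ) =
      metricInTrivialization (γ t) (γ τ) (coordAlong γ W t τ) (coordAlong γ W' t τ) := by
    intro τ hτ
    rw [metricInTrivialization_apply hτ, ← he, hsymm W hτ, hsymm W' hτ]
  refine (hD.congr_of_eventuallyEq (hnhds.mono hval) (hval t hmem)).congr_deriv ?_
  rw [metricInTrivialization_apply hmem, metricInTrivialization_apply hmem, ← he, hconst,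
    hsymm W hmem, hsymm W' hmem, covDerivAlong_eq, covDerivAlong_eq, inner_add_left,
    inner_add_right, Trivialization.symmL_apply _ hmem, Trivialization.symmL_apply _ hmem]
  ring

/-- The case of `covDerivAlong_comp` of a field with constant coordinates near `γ t`. -/
theorem covDerivAlong_extend_comp {γ : ℝ → M} {s : Set ℝ} {t : ℝ}
    (hγ : ContinuousWithinAt γ s t) (u : TangentSpace 𝓘(ℝ, E) (γ t)) :
    DifferentiableWithinAt ℝ (coordAlong γ (fun τ ↦ FiberBundle.extend E u (γ τ)) t) s t ∧
    covDerivAlong γ s (fun τ ↦ FiberBundle.extend E u (γ τ)) t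
      = leviCivita (FiberBundle.extend E u) (γ t) (velocity γ s t) := by
  set e := trivializationAt E (TangentSpace 𝓘(ℝ, E) : M → Type _) (γ t) with he
  have hmem : γ t ∈ e.baseSet := FiberBundle.mem_baseSet_trivializationAt' (γ t)
  have hnhds : ∀ᶠ τ in 𝓝[s] t, γ τ ∈ e.baseSet := hγ (e.open_baseSet.mem_nhds hmem)
  have hval : ∀ τ, γ τ ∈ e.baseSet →
      coordAlong γ (fun τ ↦ FiberBundle.extend E u (γ τ)) t τ = (e ⟨γ t, u⟩).2 := by
    intro τ hτ
    simp [coordAlong, FiberBundle.extend, ← he, hτ]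
  have h := (hasDerivWithinAt_const t s (e ⟨γ t, u⟩).2).congr_of_eventuallyEq
    (hnhds.mono hval) (hval t hmem)
  refine ⟨h.differentiableWithinAt, ?_⟩
  have h0 : derivWithin (coordAlong γ (fun τ ↦ FiberBundle.extend E u (γ τ)) t) s t = 0 := by
    by_cases hs : UniqueDiffWithinAt ℝ s t
    · exact h.derivWithin hs
    · exact derivWithin_zero_of_not_uniqueDiffWithinAt hs
  rw [covDerivAlong_eq, FiberBundle.extend_apply_self, h0, map_zero, zero_add]

/-- The covariant derivative along a curve extends the Levi-Civita connection. Both sides are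
compared through the derivative of `⟨Y ∘ γ, Z ∘ γ⟩`, where `Z` has constant coordinates. -/
theorem covDerivAlong_comp {γ : ℝ → M} {s : Set ℝ} {t : ℝ}
    {Y : Π x : M, TangentSpace 𝓘(ℝ, E) x} (hs : UniqueDiffWithinAt ℝ s t) (ht : t ∈ s)
    (hγ : ContMDiffOn 𝓘(ℝ, ℝ) 𝓘(ℝ, E) ∞ γ s) (hY : MDiffAt (T% Y) (γ t)) :
    covDerivAlong γ s (fun τ ↦ Y (γ τ)) t = leviCivita Y (γ t) (velocity γ s t) := by
  refine ext_inner_right ℝ fun u ↦ ?_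
  have hγt := (hγ t ht).mdifferentiableWithinAt (by simp)
  have hu := FiberBundle.mdifferentiableAt_extend 𝓘(ℝ, E) E u
  obtain ⟨hd, hD⟩ := covDerivAlong_extend_comp (s := s) (hγ t ht).continuousWithinAt u
  have h1 := hasDerivWithinAt_inner_along hs ht hγ
    (differentiableWithinAt_coordAlong_comp hγt hY) hd
  have h2 := hasDerivWithinAt_comp_curve hs (mdifferentiableAt_inner hY hu) hγt
  have h3 := mvfderiv_inner_eq_leviCivita
    (FiberBundle.mdifferentiableAt_extend 𝓘(ℝ, E) E (velocity γ s t)) hY hu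
  have h4 := hs.eq_deriv s h1 h2
  simp only [FiberBundle.extend_apply_self, hD] at h3 h4
  linarith

end

/-! ### Geodesics and convexity -/

section
variable {E : Type*} [NormedAddCommGroup E] [NormedSpace ℝ E] [FiniteDimensional ℝ E]
  {M : Type*} [TopologicalSpace M] [ChartedSpace E M] [IsManifold 𝓘(ℝ, E) ∞ M]
  [RiemannianBundle (fun x : M ↦ TangentSpace 𝓘(ℝ, E) x)]
  [IsContMDiffRiemannianBundle 𝓘(ℝ, E) ∞ E (fun x : M ↦ TangentSpace 𝓘(ℝ, E) x)]

namespace IsGeodesicSegment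

variable {γ : ℝ → M} {a b : ℝ}

theorem hasDerivWithinAt_inner_velocity (hab : a < b) (hγ : IsGeodesicSegment (E := E) γ a b)
    {Y : Π x : M, TangentSpace 𝓘(ℝ, E) x} {t : ℝ} (ht : t ∈ Icc a b)
    (hY : MDiffAt (T% Y) (γ t)) :
    HasDerivWithinAt (fun τ ↦ (inner ℝ (Y (γ τ)) (velocity γ (Icc a b) τ) : ℝ))
      (inner ℝ (leviCivita Y (γ t) (velocity γ (Icc a b) t)) (velocity γ (Icc a b) t))
      (Icc a b) t := by
  have hu := uniqueDiffOn_Icc hab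
  have hγt := (hγ.1 t ht).mdifferentiableWithinAt (by simp)
  have h := hasDerivWithinAt_inner_along (hu t ht) ht hγ.1
    (differentiableWithinAt_coordAlong_comp hγt hY)
    (differentiableWithinAt_coordAlong_velocity hu ht hγ.1)
  rwa [covDerivAlong_comp (hu t ht) ht hγ.1 hY, hγ.2 t ht, inner_zero_right, add_zero] at h

theorem norm_velocity_eq (hab : a < b) (hγ : IsGeodesicSegment (E := E) γ a b)
    {t : ℝ} (ht : t ∈ Icc a b) :
    ‖velocity (E := E) γ (Icc a b) t‖ = ‖velocity (E := E) γ (Icc a b) a‖ := by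
  have hu := uniqueDiffOn_Icc hab
  have h : ∀ t ∈ Icc a b, HasDerivWithinAt (fun τ ↦ (inner ℝ (velocity (E := E) γ (Icc a b) τ)
      (velocity γ (Icc a b) τ) : ℝ)) 0 (Icc a b) t := by
    intro t ht
    have hv := differentiableWithinAt_coordAlong_velocity (E := E) hu ht hγ.1
    have h := hasDerivWithinAt_inner_along (hu t ht) ht hγ.1 hv hv
    rwa [hγ.2 t ht, inner_zero_right, inner_zero_left, add_zero] at h
  have h0 := constant_of_derivWithin_zero (fun t ht ↦ (h t ht).differentiableWithinAt)
    (fun t ht ↦ (h t (Ico_subset_Icc_self ht)).derivWithin (hu t (Ico_subset_Icc_self ht))) t ht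
  simp only [real_inner_self_eq_norm_sq] at h0
  exact (sq_eq_sq₀ (norm_nonneg _) (norm_nonneg _)).1 h0

end IsGeodesicSegment

omit [FiniteDimensional ℝ E] in
/-- The length of `γ` bounds the distance of its points from `γ a`. -/
theorem eq_left_of_velocity_eq_zero {M : Type*} [EMetricSpace M] [ChartedSpace E M]
    [IsManifold 𝓘(ℝ, E) ∞ M] [RiemannianBundle (fun x : M ↦ TangentSpace 𝓘(ℝ, E) x)]
    [IsRiemannianManifold 𝓘(ℝ, E) M] {γ : ℝ → M} {a b : ℝ}
    (hγ : ContMDiffOn 𝓘(ℝ, ℝ) 𝓘(ℝ, E) 1 γ (Icc a b))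
    (h0 : ∀ t ∈ Icc a b, velocity (E := E) γ (Icc a b) t = 0) {t : ℝ} (ht : t ∈ Icc a b) :
    γ t = γ a := by
  have h1 : Manifold.pathELength 𝓘(ℝ, E) γ a b = 0 := by
    rw [Manifold.pathELength_eq_lintegral_mfderivWithin_Icc,
      MeasureTheory.setLIntegral_congr_fun (g := 0) measurableSet_Icc]
    · simp
    · intro τ hτ
      simpa using! h0 τ hτ
  have h2 : edist (γ a) (γ t) ≤ 0 := by
    rw [IsRiemannianManifold.out (I := 𝓘(ℝ, E)) (γ a) (γ t), ← h1]
    exact (Manifold.riemannianEDist_le_pathELength (hγ.mono (Icc_subset_Icc_right ht.2)) rfl rfl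
      ht.1).trans (Manifold.pathELength_mono le_rfl ht.2)
  exact (edist_le_zero.1 h2).symm

namespace IsClosedConformal

variable {V : Π x : M, TangentSpace 𝓘(ℝ, E) x} {φ : M → ℝ} {γ : ℝ → M} {a b : ℝ}

theorem hasDerivWithinAt_half_inner_comp (hV : IsClosedConformal V φ) (hab : a < b)
    (hγ : IsGeodesicSegment (E := E) γ a b) {t : ℝ} (ht : t ∈ Icc a b) :
    HasDerivWithinAt (fun τ ↦ 1 / 2 * (inner ℝ (V (γ τ)) (V (γ τ)) : ℝ))
      (φ (γ t) * inner ℝ (V (γ t)) (velocity γ (Icc a b) t)) (Icc a b) t := by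
  have h := hasDerivWithinAt_comp_curve (uniqueDiffOn_Icc hab t ht)
    ((hV.contMDiff_half_inner (γ t)).mdifferentiableAt (by simp))
    ((hγ.1 t ht).mdifferentiableWithinAt (by simp))
  rwa [hV.mvfderiv_half_inner] at h

theorem hasDerivWithinAt_factor_mul_inner_velocity (hV : IsClosedConformal V φ) (hab : a < b)
    (hγ : IsGeodesicSegment (E := E) γ a b) {t : ℝ} (ht : t ∈ Icc a b) :
    HasDerivWithinAt (fun τ ↦ φ (γ τ) * (inner ℝ (V (γ τ)) (velocity γ (Icc a b) τ) : ℝ))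
      (mvfderiv 𝓘(ℝ, E) φ (γ t) (velocity γ (Icc a b) t)
          * inner ℝ (V (γ t)) (velocity γ (Icc a b) t)
        + φ (γ t) ^ 2 * ‖velocity (E := E) γ (Icc a b) t‖ ^ 2) (Icc a b) t := by
  have h1 := hasDerivWithinAt_comp_curve (uniqueDiffOn_Icc hab t ht)
    (hV.mdifferentiableAt_factor (γ t)) ((hγ.1 t ht).mdifferentiableWithinAt (by simp))
  have h2 := hγ.hasDerivWithinAt_inner_velocity hab ht (hV.mdifferentiableAt_field (γ t))
  refine (h1.mul h2).congr_deriv ?_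
  rw [hV.deriv_eq, inner_smul_left, real_inner_self_eq_norm_sq, RCLike.conj_to_real]
  ring

theorem convexOn_half_inner_comp (hV : IsClosedConformal V φ)
    (hφV : ∀ x : M, 0 ≤ inner ℝ (gradient (E := E) φ x) (V x)) (hab : a < b)
    (hγ : IsGeodesicSegment (E := E) γ a b) :
    ConvexOn ℝ (Icc a b) (fun τ ↦ 1 / 2 * (inner ℝ (V (γ τ)) (V (γ τ)) : ℝ)) := by
  refine convexOn_of_hasDerivWithinAt2_nonneg (convex_Icc a b)
    (fun t ht ↦ (hV.hasDerivWithinAt_half_inner_comp hab hγ ht).continuousWithinAt)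
    (fun t ht ↦ (hV.hasDerivWithinAt_half_inner_comp hab hγ (interior_subset ht)).mono
      interior_subset)
    (fun t ht ↦ (hV.hasDerivWithinAt_factor_mul_inner_velocity hab hγ (interior_subset ht)).mono
      interior_subset) fun t _ ↦ ?_
  have := hV.mvfderiv_factor_mul_inner_nonneg hφV (γ t) (velocity γ (Icc a b) t)
  positivity

theorem strictConvexOn_half_inner_comp (hV : IsClosedConformal V φ)
    (hφV : ∀ x : M, 0 ≤ inner ℝ (gradient (E := E) φ x) (V x)) (hφ : ∀ x, φ x ≠ 0) (hab : a < b)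
    (hγ : IsGeodesicSegment (E := E) γ a b)
    (hv : ∀ t ∈ Icc a b, velocity (E := E) γ (Icc a b) t ≠ 0) :
    StrictConvexOn ℝ (Icc a b) (fun τ ↦ 1 / 2 * (inner ℝ (V (γ τ)) (V (γ τ)) : ℝ)) := by
  set g' : ℝ → ℝ := fun τ ↦ φ (γ τ) * (inner ℝ (V (γ τ)) (velocity γ (Icc a b) τ) : ℝ)
  have hd := fun t ht ↦ hV.hasDerivWithinAt_factor_mul_inner_velocity hab hγ (t := t) ht
  have hmono : StrictMonoOn g' (Icc a b) := by
    refine strictMonoOn_of_deriv_pos (convex_Icc a b) (fun t ht ↦ (hd t ht).continuousWithinAt)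
      fun t ht ↦ ?_
    have h := hV.mvfderiv_factor_mul_inner_nonneg hφV (γ t) (velocity γ (Icc a b) t)
    have h1 := norm_pos_iff.2 (hv t (interior_subset ht))
    have h2 := hφ (γ t)
    rw [((hd t (interior_subset ht)).hasDerivAt (mem_interior_iff_mem_nhds.1 ht)).deriv]
    positivity
  refine StrictMonoOn.strictConvexOn_of_deriv (convex_Icc a b)
    (fun t ht ↦ (hV.hasDerivWithinAt_half_inner_comp hab hγ ht).continuousWithinAt)
    ((hmono.mono interior_subset).congr fun t ht ↦ ?_)
  exact ((hV.hasDerivWithinAt_half_inner_comp hab hγ (interior_subset ht)).hasDerivAt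
    (mem_interior_iff_mem_nhds.1 ht)).deriv.symm

theorem isConvex_half_inner (hV : IsClosedConformal V φ)
    (hφV : ∀ x : M, 0 ≤ inner ℝ (gradient (E := E) φ x) (V x)) :
    IsConvex E (fun x ↦ 1 / 2 * (inner ℝ (V x) (V x) : ℝ)) := by
  intro γ a b hab hγ t ht
  exact (hV.convexOn_half_inner_comp hφV hab hγ).2 (left_mem_Icc.2 hab.le) (right_mem_Icc.2 hab.le)
    (sub_nonneg.2 ht.2) ht.1 (sub_add_cancel 1 t)

end IsClosedConformal
end

end RiemGeom

end

theorem theorem4p1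
    {E : Type*} [NormedAddCommGroup E] [NormedSpace ℝ E] [FiniteDimensional ℝ E]
    {M : Type*} [EMetricSpace M] [ChartedSpace E M] [IsManifold 𝓘(ℝ, E) ∞ M]
    [RiemannianBundle (fun x : M ↦ TangentSpace 𝓘(ℝ, E) x)]
    [IsContMDiffRiemannianBundle 𝓘(ℝ, E) ∞ E (fun x : M ↦ TangentSpace 𝓘(ℝ, E) x)]
    [IsRiemannianManifold 𝓘(ℝ, E) M]
    [CompleteSpace M] [NoncompactSpace M]
    (V : Π x : M, TangentSpace 𝓘(ℝ, E) x) (φ : M → ℝ)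
    (hV : RiemGeom.IsClosedConformal V φ)
    (hφV : ∀ x : M, 0 ≤ inner ℝ (RiemGeom.gradient (E := E) φ x) (V x)) :
    RiemGeom.IsConvex E (fun x ↦ 1 / 2 * inner ℝ (V x) (V x)) ∧
    (∀ (x : M) (v : TangentSpace 𝓘(ℝ, E) x),
      φ x ^ 2 * inner ℝ v v ≤
        inner ℝ (RiemGeom.hessian (fun y ↦ 1 / 2 * inner ℝ (V y) (V y)) x v) v) ∧
    ((∀ x, V x ≠ 0) → (∀ x, φ x ≠ 0) →
      RiemGeom.IsStrictConvex E (fun x ↦ 1 / 2 * inner ℝ (V x) (V x))) := by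
  refine ⟨hV.isConvex_half_inner hφV, hV.sq_factor_mul_inner_le_inner_hessian hφV,
    fun _ hφ ↦ ⟨hV.isConvex_half_inner hφV, fun γ a b hab hγ ⟨s, hs, hne⟩ t ht ↦ ?_⟩⟩
  -- The speed is constant, and a curve of zero speed is constant.
  have hv : ∀ τ ∈ Icc a b, RiemGeom.velocity (E := E) γ (Icc a b) τ ≠ 0 := by
    intro τ hτ h0
    refine hne (RiemGeom.eq_left_of_velocity_eq_zero (E := E) (hγ.1.of_le (by simp))
      (fun r hr ↦ ?_) hs)
    rw [← norm_eq_zero, hγ.norm_velocity_eq hab hr, ← hγ.norm_velocity_eq hab hτ, h0, norm_zero]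
  exact (hV.strictConvexOn_half_inner_comp hφV hφ hab hγ hv).2 (left_mem_Icc.2 hab.le)
    (right_mem_Icc.2 hab.le) hab.ne (sub_pos.2 ht.2) ht.1 (sub_add_cancel 1 t)
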